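/- For each integer $n\ge 2$, let $n$ players simultaneously shoot one shot each: player $i$ chooses a target $T_{n,i}$ uniformly at random among the other $n-1$ players, the choices of different players being independent, and every player who is shot dies. Let $\xi_n$ be the number of players who survive, that is, the number of players whom nobody has chosen as a target. Then, as $n\to\infty$, $$\sqrt{n}\left(\frac{\xi_n}{n}-\frac1e\right)\longrightarrow N\!\left(0,\ \frac1e-\frac{2}{e^2}\right)\quad\text{in distribution.}$$ -/

import Mathlib

open MeasureTheory ProbabilityTheory Filter
open scoped NNReal

/-- The number of survivors of one round among the players `0, …, n - 1` when player `j` shoots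
(and kills) player `t j`: the number of players whom nobody shoots. -/
def survivorCount {n : ℕ} (t : Fin n → Fin n) : ℕ :=
  (Finset.univ.filter fun i : Fin n => ∀ j : Fin n, t j ≠ i).card

theorem rouletteVariance_pos : 0 < 1 / Real.exp 1 - 2 / Real.exp 1 ^ 2 := by
  have h : (2 : ℝ) < Real.exp 1 := by linarith [Real.exp_one_gt_d9]
  have h0 : (0 : ℝ) < Real.exp 1 := Real.exp_pos 1
  have h1 : 1 / Real.exp 1 - 2 / Real.exp 1 ^ 2 = (Real.exp 1 - 2) / Real.exp 1 ^ 2 := by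
    field_simp
  rw [h1]
  exact div_pos (by linarith) (by positivity)

/-- The limiting variance `1/e - 2/e²`, as a nonnegative real number. -/
noncomputable def rouletteVariance : ℝ≥0 :=
  ⟨1 / Real.exp 1 - 2 / Real.exp 1 ^ 2, rouletteVariance_pos.le⟩

/-! Allow players to shoot themselves: survivors become the empty boxes when `n` balls fall
uniformly into `n` boxes. This changes each target law by `2/n` in `ℓ¹`, hence by `2` in all, while
altering one target moves `exp(it√n(ξ/n - 1/e))` by at most `|t|/√n`. By `norm_sum_prod_smul_sub_le`
the characteristic functions differ by `O(1/√n)`.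

The uniform model is independent Poisson(1) boxes conditioned on having `n` points in total. Fourier
inversion in the total writes its characteristic function as a constant times `∫ boxKernel ^ n`
(`integral_boxKernel_pow`). The integrand tends pointwise to a Gaussian (`tendsto_boxKernel_pow`)
under a Gaussian bound (`norm_boxKernel_le`), Stirling's formula gives the constant, and Lévy's
continuity theorem concludes. -/

theorem survivorCount_add_card_image {n : ℕ} (t : Fin n → Fin n) :
    survivorCount t + (Finset.univ.image t).card = n := by
  have h : (Finset.univ.filter fun i : Fin n => ∀ j : Fin n, t j ≠ i) =
      (Finset.univ.image t)ᶜ := by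
    ext i; simp
  rw [survivorCount, h, Finset.card_compl, Fintype.card_fin]
  have := Finset.card_le_univ (Finset.univ.image t)
  rw [Fintype.card_fin] at this
  omega

theorem card_image_update_le {ι α : Type*} [Fintype ι] [DecidableEq ι] [DecidableEq α]
    (t : ι → α) (i : ι) (a : α) :
    (Finset.univ.image (Function.update t i a)).card ≤ (Finset.univ.image t).card + 1 := by
  refine (Finset.card_le_card ?_).trans (Finset.card_insert_le a _)
  intro x hx
  obtain ⟨j, -, rfl⟩ := Finset.mem_image.1 hx
  by_cases hj : j = i
  · subst hj; simp
  · simp [Function.update_of_ne hj]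

theorem abs_survivorCount_update_sub_le {n : ℕ} (t : Fin n → Fin n) (i a : Fin n) :
    |(survivorCount (Function.update t i a) : ℝ) - survivorCount t| ≤ 1 := by
  have h1 := survivorCount_add_card_image t
  have h2 := survivorCount_add_card_image (Function.update t i a)
  have h3 := card_image_update_le t i a
  -- Undoing the update is itself an update, which gives the reverse inequality.
  have h4 := card_image_update_le (Function.update t i a) i (t i)
  rw [Function.update_idem, Function.update_eq_self] at h4
  have h5 : survivorCount (Function.update t i a) ≤ survivorCount t + 1 := by omega
  have h6 : survivorCount t ≤ survivorCount (Function.update t i a) + 1 := by omega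
  have h5' : (survivorCount (Function.update t i a) : ℝ) ≤ survivorCount t + 1 := by
    exact_mod_cast h5
  have h6' : (survivorCount t : ℝ) ≤ survivorCount (Function.update t i a) + 1 := by
    exact_mod_cast h6
  rw [abs_le]; constructor <;> linarith

/-! ### Changing the marginals of a product law -/

theorem sum_fin_succ_pi {α E : Type*} [Fintype α] [AddCommMonoid E] {n : ℕ}
    (f : (Fin (n + 1) → α) → E) :
    ∑ t, f t = ∑ a, ∑ t : Fin n → α, f (Fin.cons a t) := by
  rw [← (Fin.consEquiv fun _ : Fin (n + 1) => α).sum_comp, Fintype.sum_prod_type]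
  rfl

theorem sum_prod_fin_eq_one {α : Type*} [Fintype α] {n : ℕ} {q : Fin n → α → ℝ}
    (hq : ∀ i, ∑ a, q i a = 1) : ∑ t : Fin n → α, ∏ i, q i (t i) = 1 := by
  rw [← Fintype.piFinset_univ, ← Finset.prod_univ_sum]
  simp [hq]

/-- Replacing the marginals of a product law on a finite product changes the mean of a function
with bounded differences by at most the sum of the `ℓ¹` distances of the marginals. -/
theorem norm_sum_prod_smul_sub_le {α E : Type*} [Fintype α] [NormedAddCommGroup E]
    [NormedSpace ℝ E] {D : ℝ} :
    ∀ {n : ℕ} (p q : Fin n → α → ℝ) (F : (Fin n → α) → E),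
      (∀ i a, 0 ≤ p i a) → (∀ i, ∑ a, p i a = 1) → (∀ i a, 0 ≤ q i a) → (∀ i, ∑ a, q i a = 1) →
      (∀ t i a, ‖F (Function.update t i a) - F t‖ ≤ D) →
      ‖∑ t, (∏ i, p i (t i)) • F t - ∑ t, (∏ i, q i (t i)) • F t‖ ≤
        D * ∑ i, ∑ a, |p i a - q i a|
  | 0, p, q, F, _, _, _, _, _ => by simp
  | n + 1, p, q, F, hp, hp1, hq, hq1, hF => by
    have ih (a : α) := norm_sum_prod_smul_sub_le (fun i => p i.succ) (fun i => q i.succ)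
      (fun t => F (Fin.cons a t)) (fun i => hp i.succ) (fun i => hp1 i.succ)
      (fun i => hq i.succ) (fun i => hq1 i.succ)
      (fun t i b => by rw [Fin.cons_update]; exact hF _ _ _)
    set A : α → E := fun a => ∑ t : Fin n → α, (∏ i, p i.succ (t i)) • F (Fin.cons a t)
    set B : α → E := fun a => ∑ t : Fin n → α, (∏ i, q i.succ (t i)) • F (Fin.cons a t)
    set R := ∑ i : Fin n, ∑ a, |p i.succ a - q i.succ a|
    have hA : ∑ t, (∏ i, p i (t i)) • F t = ∑ a, p 0 a • A a := by
      rw [sum_fin_succ_pi]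
      simp [A, Finset.smul_sum, Fin.prod_univ_succ, mul_smul]
    have hB : ∑ t, (∏ i, q i (t i)) • F t = ∑ a, q 0 a • B a := by
      rw [sum_fin_succ_pi]
      simp [B, Finset.smul_sum, Fin.prod_univ_succ, mul_smul]
    have hne : Nonempty α := by
      by_contra h
      rw [not_nonempty_iff] at h
      simpa using hp1 0
    obtain ⟨a₀⟩ := hne
    have hBa (a : α) : ‖B a - B a₀‖ ≤ D := by
      rw [← Finset.sum_sub_distrib]
      calc _ ≤ ∑ t : Fin n → α, (∏ i, q i.succ (t i)) * D := by
            refine norm_sum_le_of_le _ fun t _ => ?_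
            have h0 : 0 ≤ ∏ i, q i.succ (t i) := Finset.prod_nonneg fun i _ => hq _ _
            rw [← smul_sub, norm_smul, Real.norm_of_nonneg h0]
            refine mul_le_mul_of_nonneg_left ?_ h0
            have := hF (Fin.cons a₀ t) 0 a
            rwa [Fin.update_cons_zero] at this
        _ = D := by rw [← Finset.sum_mul, sum_prod_fin_eq_one fun i => hq1 i.succ, one_mul]
    -- Since `p 0 - q 0` has total mass zero, `B a₀` may be subtracted for free, so only the
    -- oscillation of `B` counts.
    have hsplit : ∑ a, p 0 a • A a - ∑ a, q 0 a • B a =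
        ∑ a, p 0 a • (A a - B a) + ∑ a, (p 0 a - q 0 a) • (B a - B a₀) := by
      have h0 : ∑ a, (p 0 a - q 0 a) • B a₀ = 0 := by
        rw [← Finset.sum_smul, Finset.sum_sub_distrib, hp1, hq1, sub_self, zero_smul]
      simp only [smul_sub, sub_smul, Finset.sum_sub_distrib] at h0 ⊢
      rw [h0]
      abel
    rw [hA, hB, hsplit, Fin.sum_univ_succ, mul_add, add_comm]
    refine (norm_add_le _ _).trans (add_le_add ?_ ?_)
    · rw [Finset.mul_sum]
      refine norm_sum_le_of_le _ fun a _ => ?_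
      rw [norm_smul, Real.norm_eq_abs, mul_comm]
      exact mul_le_mul_of_nonneg_right (hBa a) (abs_nonneg _)
    · calc _ ≤ ∑ a, p 0 a * (D * R) := by
            refine norm_sum_le_of_le _ fun a _ => ?_
            rw [norm_smul, Real.norm_of_nonneg (hp 0 a)]
            exact mul_le_mul_of_nonneg_left (ih a) (hp 0 a)
        _ = D * R := by rw [← Finset.sum_mul, hp1, one_mul]

/-! ### Generating function of the empty boxes and its integral form -/

/-- Inclusion–exclusion: `z ^ ξ` is the sum of `(z - 1) ^ |S|` over sets `S` of empty boxes, and `(n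
- |S|) ^ n` maps avoid `S`. -/
theorem sum_pow_survivorCount (n : ℕ) (z : ℂ) :
    ∑ t : Fin n → Fin n, z ^ survivorCount t =
      ∑ k ∈ Finset.range (n + 1), (n.choose k : ℂ) * (z - 1) ^ k * ((n - k : ℕ) : ℂ) ^ n := by
  classical
  have h (t : Fin n → Fin n) : z ^ survivorCount t =
      ∑ S : Finset (Fin n), if (∀ i ∈ S, ∀ j, t j ≠ i) then (z - 1) ^ S.card else 0 := by
    rw [survivorCount, ← Finset.sum_filter]
    have : (Finset.univ.filter fun S : Finset (Fin n) => ∀ i ∈ S, ∀ j, t j ≠ i) =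
        (Finset.univ.filter fun i : Fin n => ∀ j : Fin n, t j ≠ i).powerset := by
      ext S; simp [Finset.subset_iff]
    rw [this, Finset.sum_powerset_apply_card (fun k => (z - 1) ^ k)]
    have := add_pow (z - 1) 1 (Finset.univ.filter fun i : Fin n => ∀ j : Fin n, t j ≠ i).card
    simpa [mul_comm] using this
  simp_rw [h]
  rw [Finset.sum_comm]
  have h2 (S : Finset (Fin n)) :
      (∑ t : Fin n → Fin n, if (∀ i ∈ S, ∀ j, t j ≠ i) then (z - 1) ^ S.card else 0) =
        (z - 1) ^ S.card * ((n - S.card : ℕ) : ℂ) ^ n := by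
    rw [← Finset.sum_filter, Finset.sum_const]
    have : (Finset.univ.filter fun t : Fin n → Fin n => ∀ i ∈ S, ∀ j, t j ≠ i) =
        Fintype.piFinset fun _ => Sᶜ := by
      ext t; simp; grind
    rw [this, Fintype.card_piFinset]
    simp [Finset.card_compl, mul_comm]
  simp_rw [h2]
  rw [← Finset.powerset_univ, Finset.sum_powerset_apply_card
    (fun k => (z - 1) ^ k * ((n - k : ℕ) : ℂ) ^ n)]
  simp [mul_assoc]

/-- Cauchy's formula for the `n`-th Taylor coefficient of `exp (m z)` on the unit circle. -/
theorem integral_exp_mul_exp_mul_exp (n : ℕ) (m : ℂ) :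
    ∫ θ in (-Real.pi)..Real.pi,
      Complex.exp (-(Complex.I * n * θ)) * Complex.exp (m * Complex.exp (Complex.I * θ)) =
        2 * Real.pi / n.factorial * m ^ n := by
  have hper : Function.Periodic (fun θ : ℝ =>
      Complex.exp (-(Complex.I * n * θ)) * Complex.exp (m * Complex.exp (Complex.I * θ)))
      (2 * Real.pi) := by
    intro θ
    have h1 : Complex.exp (Complex.I * ((θ + 2 * Real.pi : ℝ) : ℂ)) =
        Complex.exp (Complex.I * θ) := by
      have := Complex.exp_periodic (Complex.I * θ)
      rw [← this]; congr 1; push_cast; ring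
    have h2 (x : ℝ) : Complex.exp (-(Complex.I * n * x)) = (Complex.exp (Complex.I * x) ^ n)⁻¹ := by
      rw [Complex.exp_neg, ← Complex.exp_nat_mul]; congr 2; ring
    simp only [h2, h1]
  have hshift := hper.intervalIntegral_add_eq (-Real.pi) 0
  rw [show -Real.pi + 2 * Real.pi = Real.pi by ring, zero_add] at hshift
  rw [hshift]
  have hd : DifferentiableOn ℂ (fun z : ℂ => Complex.exp (m * z)) (Metric.closedBall 0 1) := by
    fun_prop
  have hc := hd.circleIntegral_one_div_sub_center_pow_smul one_pos n
  rw [circleIntegral, iteratedDeriv_cexp_const_mul] at hc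
  have hI : Complex.I ≠ 0 := Complex.I_ne_zero
  have heq : ∀ θ : ℝ, deriv (circleMap 0 1) θ •
      (1 / (circleMap 0 1 θ - 0) ^ (n + 1)) • Complex.exp (m * circleMap 0 1 θ) =
      Complex.I * (Complex.exp (-(Complex.I * n * θ)) *
        Complex.exp (m * Complex.exp (Complex.I * θ))) := by
    intro θ
    have h2 : Complex.exp (-(Complex.I * n * θ)) = (Complex.exp (Complex.I * θ) ^ n)⁻¹ := by
      rw [Complex.exp_neg, ← Complex.exp_nat_mul]; congr 2; ring
    have h3 := Complex.exp_ne_zero (Complex.I * θ)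
    simp only [deriv_circleMap, circleMap, Complex.ofReal_one, one_mul, zero_add, sub_zero,
      smul_eq_mul, h2]
    rw [mul_comm (θ : ℂ) Complex.I]
    field_simp
    ring
  simp only [heq] at hc
  rw [intervalIntegral.integral_const_mul] at hc
  apply mul_left_cancel₀ hI
  rw [hc]
  simp
  ring

theorem integral_exp_mul_pow_exp_exp_add (n : ℕ) (w : ℂ) :
    ∫ θ in (-Real.pi)..Real.pi,
      Complex.exp (-(Complex.I * n * θ)) * (Complex.exp (Complex.exp (Complex.I * θ)) + w) ^ n =
        2 * Real.pi / n.factorial *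
          ∑ k ∈ Finset.range (n + 1), (n.choose k : ℂ) * w ^ k * ((n - k : ℕ) : ℂ) ^ n := by
  have h (θ : ℝ) : Complex.exp (-(Complex.I * n * θ)) *
      (Complex.exp (Complex.exp (Complex.I * θ)) + w) ^ n =
      ∑ k ∈ Finset.range (n + 1), (n.choose k : ℂ) * w ^ k *
        (Complex.exp (-(Complex.I * n * θ)) *
          Complex.exp (((n - k : ℕ) : ℂ) * Complex.exp (Complex.I * θ))) := by
    rw [add_comm, add_pow, Finset.mul_sum]
    refine Finset.sum_congr rfl fun k _ => ?_
    rw [← Complex.exp_nat_mul]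
    ring
  simp_rw [h]
  rw [intervalIntegral.integral_finsetSum fun k _ =>
    Continuous.intervalIntegrable (by fun_prop) _ _]
  simp_rw [intervalIntegral.integral_const_mul, integral_exp_mul_exp_mul_exp, Finset.mul_sum]
  refine Finset.sum_congr rfl fun k _ => by ring

/-! ### Poissonisation and the limit of the Fourier integral -/

/-- The `n`-th power of this function, with `h = 1 / √n`, is the joint characteristic function of
the number of points and the number of empty boxes, centred and normalised, when `n` boxes receive
independent Poisson numbers of points of mean one. -/
noncomputable def boxKernel (t h u : ℝ) : ℂ :=
  Complex.exp (-(Complex.I * (u + t * Real.exp (-1)) * h)) *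
    (Complex.exp (Complex.exp (Complex.I * u * h) - 1) +
      (Complex.exp (Complex.I * t * h) - 1) * Real.exp (-1))

theorem continuous_boxKernel (t h : ℝ) : Continuous (boxKernel t h) := by
  unfold boxKernel; fun_prop

theorem boxKernel_eq (t h u : ℝ) :
    boxKernel t h u = Complex.exp (-1 - Complex.I * t * Real.exp (-1) * h) *
      (Complex.exp (-(Complex.I * (h * u))) *
      (Complex.exp (Complex.exp (Complex.I * (h * u))) + (Complex.exp (Complex.I * t * h) - 1))) := by
  have h1 : Complex.exp (Complex.exp (Complex.I * u * h) - 1) =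
    Complex.exp (-1) * Complex.exp (Complex.exp (Complex.I * (h * u))) := by
    rw [← Complex.exp_add]; congr 1; rw [mul_comm (h : ℂ), mul_assoc]; ring
  have h2 : Complex.exp (-(Complex.I * (u + t * Real.exp (-1)) * h)) =
     Complex.exp (- Complex.I * t * Real.exp (-1) * h) * Complex.exp (-(Complex.I * (h * u))) := by
    rw [← Complex.exp_add]; congr 1; ring
  have h3 : Complex.exp (-1 - Complex.I * t * Real.exp (-1) * h) = Complex.exp (-1) *
    Complex.exp (- Complex.I * t * Real.exp (-1) * h) := by
    rw [← Complex.exp_add]; congr 1; ring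
  rw [boxKernel, h1, h2, h3, Complex.ofReal_exp (-1)]
  push_cast
  ring

theorem boxKernel_pow (t h u : ℝ) (n : ℕ) :
    boxKernel t h u ^ n = Complex.exp (-n - Complex.I * t * Real.exp (-1) * h * n) *
      (Complex.exp (-(Complex.I * n * (h * u : ℝ))) *
      (Complex.exp (Complex.exp (Complex.I * (h * u : ℝ))) +
        (Complex.exp (Complex.I * t * h) - 1)) ^ n) := by
  rw [boxKernel_eq, mul_pow, mul_pow, ← Complex.exp_nat_mul, ← Complex.exp_nat_mul]
  push_cast
  congr 2
  · ring
  · congr 2; ring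

theorem integral_boxKernel_pow {n : ℕ} (hn : n ≠ 0) (t : ℝ) :
    ∫ u in (-(√n * Real.pi))..(√n * Real.pi), boxKernel t (√n)⁻¹ u ^ n =
      √n * (2 * Real.pi) / n.factorial * Complex.exp (-n) *
        ∑ s : Fin n → Fin n, Complex.exp
          (Complex.I * (t * (√n * ((survivorCount s : ℝ) / n - 1 / Real.exp 1)) : ℝ)) := by
  have hs : (√n : ℝ) ≠ 0 := by positivity
  have hsum : ∑ s : Fin n → Fin n, Complex.exp
      (Complex.I * (t * (√n * ((survivorCount s : ℝ) / n - 1 / Real.exp 1)) : ℝ)) =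
      Complex.exp (- Complex.I * t * Real.exp (-1) * √n) *
        ∑ s : Fin n → Fin n, Complex.exp (Complex.I * t * (√n)⁻¹) ^ survivorCount s := by
    rw [Finset.mul_sum]
    refine Finset.sum_congr rfl fun s _ => ?_
    rw [← Complex.exp_nat_mul, ← Complex.exp_add]
    congr 1
    have h1 : (√n : ℝ) / n = (√n)⁻¹ := Real.sqrt_div_self
    have h2 : t * (√n * ((survivorCount s : ℝ) / n - 1 / Real.exp 1)) =
      t * (√n)⁻¹ * survivorCount s - t * Real.exp (-1) * √n := by
      rw [← h1, Real.exp_neg]; ring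
    rw [h2]; push_cast; ring
  rw [hsum, sum_pow_survivorCount]
  simp_rw [boxKernel_pow]
  rw [intervalIntegral.integral_const_mul]
  have hsub := intervalIntegral.integral_comp_mul_left (a := -(√n * Real.pi)) (b := √n * Real.pi)
    (fun θ : ℝ => Complex.exp (-(Complex.I * n * θ)) *
      (Complex.exp (Complex.exp (Complex.I * θ)) +
        (Complex.exp (Complex.I * t * ((√n)⁻¹ : ℝ)) - 1)) ^ n) (inv_ne_zero hs)
  rw [hsub]
  have h1 : (√n)⁻¹ * (√n * Real.pi) = Real.pi := by field_simp
  have h2 : (√n)⁻¹ * -(√n * Real.pi) = -Real.pi := by field_simp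
  have h3 : Complex.exp (-n - Complex.I * t * Real.exp (-1) * ((√n)⁻¹ : ℝ) * n) =
      Complex.exp (-n) * Complex.exp (- Complex.I * t * Real.exp (-1) * √n) := by
    rw [← Complex.exp_add]; congr 1
    have : ((√n : ℝ) : ℂ) = ((√n)⁻¹ : ℝ) * n := by
      rw [← Real.sqrt_div_self]
      push_cast
      field_simp
    rw [this]; ring
  rw [h1, h2, integral_exp_mul_pow_exp_exp_add, h3, inv_inv, Complex.real_smul]
  push_cast
  ring

/-- With `x = exp (iθ)`, split `exp x - 1 = x (1 + x/2) + tail`. The tail is at most `e - 5/2`; the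
decay comes from `|1 + x/2|² = 5/4 + cos θ` and `cos θ ≤ 1 - 2θ²/π²`. -/
theorem norm_exp_exp_sub_one_le {θ : ℝ} (hθ : |θ| ≤ Real.pi) :
    ‖Complex.exp (Complex.exp (Complex.I * θ)) - 1‖ ≤
      Real.exp 1 - 1 - 2 / (3 * Real.pi ^ 2) * θ ^ 2 := by
  set x := Complex.exp (Complex.I * θ) with hx
  have hx1 : ‖x‖ = 1 := by rw [hx, mul_comm, Complex.norm_exp_ofReal_mul_I]
  have h1 := Complex.norm_exp_sub_sum_le_exp_norm_sub_sum x 3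
  simp only [Finset.sum_range_succ, Finset.range_zero, Finset.sum_empty, hx1] at h1
  norm_num at h1
  have h2 : ‖1 + x / 2‖ ≤ 3 / 2 - 2 / (3 * Real.pi ^ 2) * θ ^ 2 := by
    have hsq : ‖1 + x / 2‖ ^ 2 = 5 / 4 + Real.cos θ := by
      have hre : x.re = Real.cos θ := by
        rw [hx, mul_comm, Complex.exp_ofReal_mul_I_re]
      have him : x.im = Real.sin θ := by
        rw [hx, mul_comm, Complex.exp_ofReal_mul_I_im]
      rw [← Complex.normSq_eq_norm_sq, Complex.normSq_apply]
      simp [hre, him]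
      nlinarith [Real.sin_sq_add_cos_sq θ]
    have hcos := Real.cos_le_one_sub_mul_cos_sq hθ
    have hy : 2 / (3 * Real.pi ^ 2) * θ ^ 2 = (2 / Real.pi ^ 2 * θ ^ 2) / 3 := by
      field_simp
    set y := 2 / Real.pi ^ 2 * θ ^ 2
    rw [hy]
    have hy2 : y ≤ 2 := by
      have := Real.neg_one_le_cos θ
      linarith
    refine abs_le_of_sq_le_sq' ?_ (by linarith) |>.2
    rw [hsq]
    nlinarith [sq_nonneg y]
  have h3 : Complex.exp x - 1 = x * (1 + x / 2) + (Complex.exp x - (1 + x + x ^ 2 / 2)) := by ring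
  rw [h3]
  refine (norm_add_le _ _).trans ?_
  rw [norm_mul, hx1, one_mul]
  linarith

theorem norm_boxKernel_le {t h u : ℝ} (hu : |u * h| ≤ Real.pi) :
    ‖boxKernel t h u‖ ≤ Real.exp (-(2 / (3 * Real.pi ^ 2) * Real.exp (-1) * (u * h) ^ 2)) := by
  have h1 : ‖Complex.exp (-(Complex.I * (u + t * Real.exp (-1)) * h))‖ = 1 := by
    have := Complex.norm_exp_ofReal_mul_I (-((u + t * Real.exp (-1)) * h))
    convert this using 3; push_cast; ring
  have h2 : ‖Complex.exp (Complex.I * t * h)‖ = 1 := by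
    have := Complex.norm_exp_ofReal_mul_I (t * h)
    convert this using 3; push_cast; ring
  have h3 : Complex.exp (Complex.exp (Complex.I * u * h) - 1) +
      (Complex.exp (Complex.I * t * h) - 1) * Real.exp (-1) =
      Real.exp (-1) * ((Complex.exp (Complex.exp (Complex.I * (u * h : ℝ))) - 1) +
        Complex.exp (Complex.I * t * h)) := by
    rw [sub_eq_neg_add, Complex.exp_add, Complex.ofReal_exp]
    push_cast
    rw [← mul_assoc Complex.I]
    ring
  rw [boxKernel, norm_mul, h1, one_mul, h3, norm_mul, Complex.norm_real,
    Real.norm_of_nonneg (Real.exp_pos _).le]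
  have h4 := (norm_add_le (Complex.exp (Complex.exp (Complex.I * (u * h : ℝ))) - 1)
    (Complex.exp (Complex.I * t * h))).trans
      (add_le_add (norm_exp_exp_sub_one_le hu) h2.le)
  refine (mul_le_mul_of_nonneg_left h4 (Real.exp_pos _).le).trans ?_
  refine le_trans (le_of_eq ?_) (Real.add_one_le_exp _)
  have h5 : Real.exp (-1) * Real.exp 1 = 1 := by rw [← Real.exp_add]; simp
  linear_combination h5

/-- The centring makes the first derivative of the kernel in `h` vanish at `0`, so at `h = 1/√n` it
is `1 + F''(0)/(2n) + o(1/n)`. -/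
theorem tendsto_boxKernel_pow (t u : ℝ) :
    Tendsto (fun n : ℕ => boxKernel t (√n)⁻¹ u ^ n) atTop
      (nhds (Complex.exp (((u + t * Real.exp (-1)) ^ 2 - 2 * u ^ 2 - t ^ 2 * Real.exp (-1)) / 2))) := by
  set c : ℂ := ((Real.exp (-1) : ℝ) : ℂ)
  set a : ℂ := u + t * c with ha
  set E : ℂ → ℂ := fun h => Complex.exp (-(Complex.I * a * h))
  set X : ℂ → ℂ := fun h => Complex.exp (Complex.exp (Complex.I * u * h) - 1)
  set Y : ℂ → ℂ := fun h => Complex.exp (Complex.I * u * h)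
  set Z : ℂ → ℂ := fun h => Complex.exp (Complex.I * t * h)
  have hlin (b h : ℂ) : HasDerivAt (fun h : ℂ => b * h) b h := by
    simpa using (hasDerivAt_id h).const_mul b
  have hE (h : ℂ) : HasDerivAt E (E h * (-(Complex.I * a))) h := (hlin _ h).neg.cexp
  have hY (h : ℂ) : HasDerivAt Y (Y h * (Complex.I * u)) h := (hlin _ h).cexp
  have hZ (h : ℂ) : HasDerivAt Z (Z h * (Complex.I * t)) h := (hlin _ h).cexp
  have hX (h : ℂ) : HasDerivAt X (X h * (Y h * (Complex.I * u))) h := ((hY h).sub_const 1).cexp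
  set F : ℝ → ℂ := fun h => boxKernel t h u
  set F1 : ℂ → ℂ := fun h => E h * (-(Complex.I * a)) * (X h + (Z h - 1) * c) +
    E h * (X h * (Y h * (Complex.I * u)) + Z h * (Complex.I * t) * c)
  have hF (h : ℝ) : HasDerivAt F (F1 h) h :=
    ((hE h).mul ((hX h).add (((hZ h).sub_const 1).mul_const c))).comp_ofReal
  have hE0 : E 0 = 1 := by simp [E]
  have hX0 : X 0 = 1 := by simp [X]
  have hY0 : Y 0 = 1 := by simp [Y]
  have hZ0 : Z 0 = 1 := by simp [Z]
  have hF1 : HasDerivAt (fun h : ℝ => F1 h) (a ^ 2 - 2 * u ^ 2 - t ^ 2 * c) 0 := by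
    have := ((((hE (0 : ℝ)).mul_const (-(Complex.I * a))).mul
      ((hX (0 : ℝ)).add (((hZ (0 : ℝ)).sub_const 1).mul_const c))).add
      ((hE (0 : ℝ)).mul (((hX (0 : ℝ)).mul ((hY (0 : ℝ)).mul_const (Complex.I * u))).add
        (((hZ (0 : ℝ)).mul_const (Complex.I * t)).mul_const c)))).comp_ofReal
    convert! this using 1
    simp only [Pi.add_apply, Pi.mul_apply, Complex.ofReal_zero, hE0, hX0, hY0, hZ0]
    rw [ha]
    ring_nf
    simp only [Complex.I_sq]
    ring
  have hdF : deriv F = fun h : ℝ => F1 h := funext fun h => (hF h).deriv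
  have hcont : ContDiff ℝ 2 F := by
    have hC : ContDiff ℂ 2 fun h : ℂ => E h * (X h + (Z h - 1) * c) := by
      simp only [E, X, Z]
      fun_prop
    exact (hC.restrict_scalars ℝ).comp Complex.ofRealCLM.contDiff
  have htaylor := taylor_isLittleO_univ (x₀ := 0) hcont
  have hT (h : ℝ) : taylorWithinEval F 2 Set.univ 0 h =
      1 + (a ^ 2 - 2 * u ^ 2 - t ^ 2 * c) / 2 * h ^ 2 := by
    have h0 : F 0 = 1 := by simp [F, boxKernel]
    have h1 : F1 0 = 0 := by simp only [F1, hE0, hX0, hY0, hZ0, ha]; ring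
    have h2 : deriv (fun h : ℝ => F1 h) 0 = _ := hF1.deriv
    simp [taylor_within_apply, iteratedDerivWithin_univ, iteratedDeriv_succ,
      hdF, h0, h1, h2]
    ring
  have hlim : Tendsto (fun n : ℕ => (√n)⁻¹) atTop (nhds 0) :=
    tendsto_inv_atTop_zero.comp (Real.tendsto_sqrt_atTop.comp tendsto_natCast_atTop_atTop)
  apply Complex.tendsto_pow_exp_of_isLittleO_sub_add_div
  have hcomp := htaylor.comp_tendsto hlim
  rw [← Asymptotics.isLittleO_norm_right] at hcomp ⊢
  refine (hcomp.congr ?_ ?_)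
  · intro n
    have : (((√n)⁻¹ : ℝ) : ℂ) ^ 2 = 1 / n := by
      rw [← Complex.ofReal_pow, inv_pow, Real.sq_sqrt (by positivity)]
      simp
    simp only [Function.comp_apply, hT, this, F]
    ring
  · intro n
    simp

theorem tendsto_integral_boxKernel_pow (t : ℝ) :
    Tendsto (fun n : ℕ => ∫ u in (-(√n * Real.pi))..(√n * Real.pi), boxKernel t (√n)⁻¹ u ^ n)
      atTop (nhds ((√(2 * Real.pi) : ℝ) *
        Complex.exp (-(Real.exp (-1) - 2 * Real.exp (-1) ^ 2 : ℝ) * t ^ 2 / 2))) := by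
  set c : ℝ := Real.exp (-1)
  set κ : ℝ := 2 / (3 * Real.pi ^ 2) * c
  have hκ : 0 < κ := by positivity
  have hcont := continuous_boxKernel t
  -- Integrating out `u` completes the square. Conditioning on the total thus lowers the variance
  -- from `c - c²` to `c - 2c²`.
  have hgauss : ∫ u : ℝ,
      Complex.exp (((u + t * c) ^ 2 - 2 * u ^ 2 - t ^ 2 * c) / 2) =
        (√(2 * Real.pi) : ℝ) * Complex.exp (-(c - 2 * c ^ 2 : ℝ) * t ^ 2 / 2) := by
    have := integral_cexp_quadratic (b := -(1 / 2)) (by norm_num) (t * c)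
      ((t ^ 2 * c ^ 2 - t ^ 2 * c) / 2)
    convert! this using 3
    · congr 1; ring
    · rw [Real.sqrt_eq_rpow, Complex.ofReal_cpow (by positivity)]
      push_cast
      congr 1
      ring
    · push_cast; ring
  rw [← hgauss]
  have hint (n : ℕ) : ∫ u in (-(√n * Real.pi))..(√n * Real.pi), boxKernel t (√n)⁻¹ u ^ n =
      ∫ u, (Set.Ioc (-(√n * Real.pi)) (√n * Real.pi)).indicator
        (fun u => boxKernel t (√n)⁻¹ u ^ n) u := by
    rw [intervalIntegral.integral_of_le, integral_indicator measurableSet_Ioc]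
    have : 0 ≤ √n * Real.pi := by positivity
    linarith
  simp_rw [hint]
  refine tendsto_integral_filter_of_dominated_convergence (fun u => Real.exp (-κ * u ^ 2)) ?_ ?_
    (integrable_exp_neg_mul_sq hκ) ?_
  · exact Eventually.of_forall fun n =>
      (((hcont _).pow n).aestronglyMeasurable).indicator measurableSet_Ioc
  · filter_upwards [eventually_ne_atTop 0] with n hn
    refine Eventually.of_forall fun u => ?_
    by_cases hu : u ∈ Set.Ioc (-(√n * Real.pi)) (√n * Real.pi)
    · rw [Set.indicator_of_mem hu, norm_pow]
      have hs : 0 < √(n : ℝ) := by positivity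
      have hb : |u * (√n)⁻¹| ≤ Real.pi := by
        rw [abs_mul, abs_of_pos (inv_pos.2 hs), ← div_eq_mul_inv, div_le_iff₀ hs, mul_comm]
        exact abs_le.2 ⟨hu.1.le, hu.2⟩
      refine (pow_le_pow_left₀ (norm_nonneg _) (norm_boxKernel_le hb) n).trans_eq ?_
      rw [← Real.exp_nat_mul]
      congr 1
      rw [mul_pow, inv_pow, Real.sq_sqrt (Nat.cast_nonneg n)]
      have : (n : ℝ) ≠ 0 := by exact_mod_cast hn
      simp only [κ, c]
      field_simp
    · rw [Set.indicator_of_notMem hu, norm_zero]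
      positivity
  · refine Eventually.of_forall fun u => ?_
    refine (tendsto_boxKernel_pow t u).congr' ?_
    have hlim : Tendsto (fun n : ℕ => √n * Real.pi) atTop atTop :=
      (Real.tendsto_sqrt_atTop.comp tendsto_natCast_atTop_atTop).atTop_mul_const Real.pi_pos
    filter_upwards [hlim.eventually_gt_atTop |u|] with n hn
    rw [Set.indicator_of_mem]
    exact ⟨(abs_lt.1 hn).1, (abs_lt.1 hn).2.le⟩

/-- The mean of a normalised exponential of the number of empty boxes, for `n` balls thrown
independently and uniformly into `n` boxes. -/
theorem tendsto_uniform_survivorCount (t : ℝ) :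
    Tendsto (fun n : ℕ => ∑ s : Fin n → Fin n, (∏ _i : Fin n, (n : ℝ)⁻¹) • Complex.exp
        (Complex.I * (t * (√n * ((survivorCount s : ℝ) / n - 1 / Real.exp 1)) : ℝ)))
      atTop (nhds (Complex.exp (-(Real.exp (-1) - 2 * Real.exp (-1) ^ 2 : ℝ) * t ^ 2 / 2))) := by
  -- This factor turns the prefactor `√n · 2π · e⁻ⁿ / n!` of the integral into the uniform weight
  -- `n⁻ⁿ`.
  have hst : Tendsto (fun n : ℕ => Stirling.stirlingSeq n * (√2 / (2 * Real.pi))) atTop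
      (nhds (√Real.pi * (√2 / (2 * Real.pi)))) :=
    Stirling.tendsto_stirlingSeq_sqrt_pi.mul_const _
  have h := ((Complex.continuous_ofReal.tendsto _).comp hst).mul (tendsto_integral_boxKernel_pow t)
  have hc : ((√Real.pi * (√2 / (2 * Real.pi)) : ℝ) : ℂ) * ((√(2 * Real.pi) : ℝ) *
        Complex.exp (-(Real.exp (-1) - 2 * Real.exp (-1) ^ 2 : ℝ) * t ^ 2 / 2)) =
      Complex.exp (-(Real.exp (-1) - 2 * Real.exp (-1) ^ 2 : ℝ) * t ^ 2 / 2) := by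
    rw [← mul_assoc, ← Complex.ofReal_mul]
    have : √Real.pi * (√2 / (2 * Real.pi)) * √(2 * Real.pi) = 1 := by
      rw [Real.sqrt_mul (by norm_num)]
      have h1 := Real.mul_self_sqrt Real.pi_pos.le
      have h2 := Real.mul_self_sqrt (show (0 : ℝ) ≤ 2 by norm_num)
      have h3 := Real.pi_pos.ne'
      calc _ = (√Real.pi * √Real.pi) * (√2 * √2) / (2 * Real.pi) := by ring
        _ = 1 := by rw [h1, h2]; field_simp
    rw [this, Complex.ofReal_one, one_mul]
  rw [hc] at h
  refine h.congr' ?_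
  filter_upwards [eventually_ne_atTop 0] with n hn
  rw [integral_boxKernel_pow hn, ← Finset.smul_sum, ← mul_assoc, Complex.real_smul]
  congr 1
  have hexp : Complex.exp (-(n : ℂ)) = ((Real.exp 1 ^ n)⁻¹ : ℝ) := by
    rw [← Real.exp_nat_mul, mul_one, ← Real.exp_neg]
    push_cast
    rfl
  rw [hexp]
  simp only [Function.comp_apply]
  have hreal : Stirling.stirlingSeq n * (√2 / (2 * Real.pi)) *
      (√n * (2 * Real.pi) / n.factorial * (Real.exp 1 ^ n)⁻¹) = ∏ _i : Fin n, (n : ℝ)⁻¹ := by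
    have h0 : √(n : ℝ) ≠ 0 := by positivity
    have h1 : (n : ℝ) ≠ 0 := by positivity
    rw [Stirling.stirlingSeq, Real.sqrt_mul (by norm_num), div_pow]
    simp
    field_simp
  rw [← hreal]
  push_cast
  ring

/-! ### Forbidding self-shots -/

/-- The weights of the uniform law on the elements other than `i`. -/
noncomputable def otherWeight {n : ℕ} (i a : Fin n) : ℝ := if a = i then 0 else ((n : ℝ) - 1)⁻¹

theorem sum_otherWeight {n : ℕ} (hn : 2 ≤ n) (i : Fin n) : ∑ a, otherWeight i a = 1 := by
  have h : (2 : ℝ) ≤ n := by exact_mod_cast hn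
  have h1 : (n : ℝ) - 1 ≠ 0 := by linarith
  have : ∀ a, otherWeight i a = ((n : ℝ) - 1)⁻¹ - if a = i then ((n : ℝ) - 1)⁻¹ else 0 := by
    intro a; unfold otherWeight; split_ifs <;> simp
  simp_rw [this]
  simp
  field_simp

theorem sum_abs_otherWeight_sub {n : ℕ} (hn : 2 ≤ n) (i : Fin n) :
    ∑ a, |otherWeight i a - (n : ℝ)⁻¹| = 2 / n := by
  have h : (2 : ℝ) ≤ n := by exact_mod_cast hn
  have h1 : (n : ℝ) - 1 ≠ 0 := by linarith
  have h2 : (n : ℝ) ≠ 0 := by linarith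
  have h3 : 0 ≤ ((n : ℝ) - 1)⁻¹ - (n : ℝ)⁻¹ := by
    rw [sub_nonneg]; exact inv_anti₀ (by linarith) (by linarith)
  have (a : Fin n) : |otherWeight i a - (n : ℝ)⁻¹| = (((n : ℝ) - 1)⁻¹ - (n : ℝ)⁻¹) +
      if a = i then (n : ℝ)⁻¹ - (((n : ℝ) - 1)⁻¹ - (n : ℝ)⁻¹) else 0 := by
    unfold otherWeight
    split_ifs
    · rw [zero_sub, abs_neg, abs_of_nonneg (by positivity)]; ring
    · rw [abs_of_nonneg h3]; ring
  simp_rw [this]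
  simp [Finset.sum_add_distrib]
  field_simp
  ring

theorem norm_exp_I_mul_sub_le (x y : ℝ) :
    ‖Complex.exp (Complex.I * x) - Complex.exp (Complex.I * y)‖ ≤ |x - y| := by
  have h : Complex.exp (Complex.I * x) - Complex.exp (Complex.I * y) =
      Complex.exp (y * Complex.I) * (Complex.exp (Complex.I * (x - y : ℝ)) - 1) := by
    rw [mul_sub, ← Complex.exp_add, mul_one]
    push_cast
    congr 2 <;> ring
  rw [h, norm_mul, Complex.norm_exp_ofReal_mul_I, one_mul]
  exact Real.norm_exp_I_mul_ofReal_sub_one_le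

theorem tendsto_otherWeight_survivorCount (t : ℝ) :
    Tendsto (fun n : ℕ => ∑ s : Fin n → Fin n, (∏ i, otherWeight i (s i)) • Complex.exp
        (Complex.I * (t * (√n * ((survivorCount s : ℝ) / n - 1 / Real.exp 1)) : ℝ)))
      atTop (nhds (Complex.exp (-(Real.exp (-1) - 2 * Real.exp (-1) ^ 2 : ℝ) * t ^ 2 / 2))) := by
  refine (tendsto_uniform_survivorCount t).congr_dist ?_
  have hlim : Tendsto (fun n : ℕ => 2 * |t| * (√n)⁻¹) atTop (nhds (2 * |t| * 0)) :=
    (tendsto_inv_atTop_zero.comp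
      (Real.tendsto_sqrt_atTop.comp tendsto_natCast_atTop_atTop)).const_mul _
  rw [mul_zero] at hlim
  refine squeeze_zero' (Eventually.of_forall fun _ => dist_nonneg) ?_ hlim
  filter_upwards [eventually_ge_atTop 2] with n hn
  have h : (2 : ℝ) ≤ n := by exact_mod_cast hn
  have h0 : (n : ℝ) ≠ 0 := by linarith
  rw [dist_comm, dist_eq_norm]
  refine (norm_sum_prod_smul_sub_le (D := |t| * (√n)⁻¹) (fun i a : Fin n => otherWeight i a)
    (fun _ _ => (n : ℝ)⁻¹) _ ?_ (sum_otherWeight hn) ?_ ?_ ?_).trans_eq ?_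
  · intro i a
    unfold otherWeight
    split_ifs
    · rfl
    · exact inv_nonneg.2 (by linarith)
  · intro _ _; positivity
  · intro _; simp [h0]
  · intro s i a
    refine (norm_exp_I_mul_sub_le _ _).trans ?_
    have : t * (√n * ((survivorCount (Function.update s i a) : ℝ) / n - 1 / Real.exp 1)) -
        t * (√n * ((survivorCount s : ℝ) / n - 1 / Real.exp 1)) =
        t * (√n)⁻¹ * ((survivorCount (Function.update s i a) : ℝ) - survivorCount s) := by
      rw [← Real.sqrt_div_self (x := (n : ℝ))]
      ring
    rw [this, abs_mul, abs_mul, abs_inv, abs_of_nonneg (Real.sqrt_nonneg _)]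
    exact mul_le_of_le_one_right (by positivity) (abs_survivorCount_update_sub_le s i a)
  · simp only [sum_abs_otherWeight_sub hn]
    simp
    field_simp

/-! ### From random targets to weighted sums, and the conclusion -/

theorem uniformOn_ne_real_singleton {n : ℕ} (hn : 2 ≤ n) (i a : Fin n) :
    (uniformOn {j : Fin n | j ≠ i}).real {a} = otherWeight i a := by
  have hs : {j : Fin n | j ≠ i} = (({i}ᶜ : Finset (Fin n)) : Set (Fin n)) := by ext; simp
  have h := uniformOn_apply_finset (s := ({i}ᶜ : Finset (Fin n))) (t := {a})
  rw [Finset.coe_singleton] at h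
  rw [Measure.real, hs, h, otherWeight, ENNReal.toReal_div]
  have hc : (({i}ᶜ : Finset (Fin n)).card : ℝ) = n - 1 := by
    rw [Finset.card_compl, Finset.card_singleton, Fintype.card_fin, Nat.cast_sub (by omega)]
    simp
  split_ifs with hai
  · subst hai; simp
  · have : ({i}ᶜ ∩ {a} : Finset (Fin n)) = {a} := by
      ext x; simp; rintro rfl; exact hai
    rw [this]
    simp only [ENNReal.toReal_natCast, hc]
    simp

theorem integral_comp_otherWeight {n : ℕ} (hn : 2 ≤ n) {Ω : Type*} [MeasurableSpace Ω]
    {P : Measure Ω} {T : Fin n → Ω → Fin n}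
    (hlaw : ∀ i : Fin n, HasLaw (T i) (uniformOn {j : Fin n | j ≠ i}) P)
    (hindep : iIndepFun T P) (F : (Fin n → Fin n) → ℂ) :
    ∫ ω, F (fun i => T i ω) ∂P = ∑ s : Fin n → Fin n, (∏ i, otherWeight i (s i)) • F s := by
  have hpi := hindep.hasLaw_pi hlaw
  have hprob (i : Fin n) : IsProbabilityMeasure (uniformOn {j : Fin n | j ≠ i}) := by
    have : Nontrivial (Fin n) := Fin.nontrivial_iff_two_le.2 hn
    exact isProbabilityMeasure_uniformOn (Set.toFinite _) (exists_ne i)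
  have hint := hpi.integral_comp (f := F) (Measurable.of_discrete.aestronglyMeasurable)
  rw [← Function.comp_def F, hint, integral_fintype (Integrable.of_finite)]
  refine Finset.sum_congr rfl fun s _ => ?_
  rw [Measure.real, ← Set.univ_pi_singleton, Measure.pi_pi, ENNReal.toReal_prod]
  congr 1
  exact Finset.prod_congr rfl fun i _ => uniformOn_ne_real_singleton hn i (s i)

theorem mainTheorem4 {Ω : ℕ → Type*} [∀ n, MeasurableSpace (Ω n)]
    (P : (n : ℕ) → Measure (Ω n)) [∀ n, IsProbabilityMeasure (P n)]
    (T : (n : ℕ) → Fin n → Ω n → Fin n)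
    (hlaw : ∀ n, 2 ≤ n → ∀ i : Fin n, HasLaw (T n i) (uniformOn {j : Fin n | j ≠ i}) (P n))
    (hindep : ∀ n, 2 ≤ n → iIndepFun (T n) (P n)) :
    TendstoInDistribution
      (fun (n : ℕ) (ω : Ω n) =>
        √(n : ℝ) * ((survivorCount fun i => T n i ω : ℝ) / (n : ℝ) - 1 / Real.exp 1))
      atTop (id : ℝ → ℝ) P (gaussianReal 0 rouletteVariance) := by
  have hT (n : ℕ) : AEMeasurable (fun (ω : Ω n) (i : Fin n) => T n i ω) (P n) := by
    obtain hn | hn := le_or_gt 2 n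
    · exact ((hindep n hn).hasLaw_pi (hlaw n hn)).aemeasurable
    -- Measurability is needed for every `n`, but the laws are given only for `n ≥ 2`; below that
    -- there is at most one target map.
    · have : Subsingleton (Fin n) := Fin.subsingleton_iff_le_one.2 (by omega)
      exact (measurable_of_subsingleton_codomain _).aemeasurable
  have hmeas (n : ℕ) : AEMeasurable (fun (ω : Ω n) =>
      √(n : ℝ) * ((survivorCount fun i => T n i ω : ℝ) / (n : ℝ) - 1 / Real.exp 1)) (P n) :=
    (Measurable.of_discrete (f := fun s : Fin n → Fin n =>
      √(n : ℝ) * ((survivorCount s : ℝ) / (n : ℝ) - 1 / Real.exp 1))).comp_aemeasurable (hT n)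
  refine ⟨hmeas, aemeasurable_id, ProbabilityMeasure.tendsto_iff_tendsto_charFun.2 fun t => ?_⟩
  simp only [ProbabilityMeasure.coe_mk, Measure.map_id, charFun_gaussianReal]
  have hv : (rouletteVariance : ℝ) = Real.exp (-1) - 2 * Real.exp (-1) ^ 2 := by
    have h : (rouletteVariance : ℝ) = 1 / Real.exp 1 - 2 / Real.exp 1 ^ 2 := rfl
    rw [h, Real.exp_neg]
    ring
  have h := tendsto_otherWeight_survivorCount t
  rw [← hv] at h
  convert! h.congr' ?_ using 2
  · congr 1; simp; ring
  · filter_upwards [eventually_ge_atTop 2] with n hn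
    rw [charFun_apply_real, integral_map (hmeas n) (by fun_prop)]
    rw [← integral_comp_otherWeight hn (hlaw n hn) (hindep n hn)]
    refine integral_congr_ae (Eventually.of_forall fun ω => ?_)
    simp only
    congr 1
    push_cast
    ring
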